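/- Let $0\le q_1,q_2\le 1/2$, let $\oplus$ be addition modulo $2$, let $w_H$ be the Hamming weight, and let $H_b(x)=-x\log_2 x-(1-x)\log_2(1-x)$ (with $0\log_2 0=0$). Consider the binary multiple access channel with one dirty user, $Y=X_1\oplus X_2\oplus S_1$, where the interference vector $\mathbf s_1\in\{0,1\}^n$ has i.i.d. $\mathrm{Bernoulli}(1/2)$ components and is known non-causally to encoder $1$ only. A common-message code of block length $n$ with $M$ messages has encoders $\mathbf x_1=\mathbf x_1(w,\mathbf s_1)$, $\mathbf x_2=\mathbf x_2(w)$ with $\frac1n w_H(\mathbf x_i)\le q_i$ for all $w,\mathbf s_1$ and $i=1,2$, and a decoder $\hat w(\mathbf y)$; its rate is $\frac1n\log_2 M$, and its error probability is that of $\hat w\ne w$ for a uniform message independent of $\mathbf s_1$. A rate $R$ is achievable if there are codes, one for each $n$, whose rates are at least $R$ for all large $n$ and whose error probabilities tend to $0$ as $n\to\infty$; $C_{com}$ is the supremum of the achievable rates. Then: 1. $C_{com}=H_b(q_1)$. 2. The single-letter expression of Somekh-Baruch, Shamai and Verdú has the same value: $$\max_{U_1,X_1,X_2}\{I(U_1,X_2;Y)-I(U_1,X_2;S_1)\}=H_b(q_1),$$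 where the maximum (which is attained) is over all finite alphabets of $U_1$ and all joint distributions of the form $P(S_1)P(X_2)P(U_1|X_2,S_1)P(X_1|S_1,U_1)P(Y|X_1,X_2,S_1)$ with $S_1\sim\mathrm{Bernoulli}(1/2)$, $X_1,X_2,Y\in\{0,1\}$, $Y=X_1\oplus X_2\oplus S_1$ and $E X_i\le q_i$, $i=1,2$; mutual information is in bits. 3. For the binary doubly-dirty multiple access channel $Y=X_1\oplus X_2\oplus S_1\oplus S_2$, with independent i.i.d. $\mathrm{Bernoulli}(1/2)$ interference vectors $\mathbf s_1,\mathbf s_2$, encoders $\mathbf x_i=\mathbf x_i(w_i,\mathbf s_i)$ with $\frac1n w_H(\mathbf x_i)\le q_i$, independent uniform individual messages $w_1,w_2$, and a decoder that recovers both messages from $\mathbf y$, every achievable rate pair (defined as above) satisfies $R_1+R_2\le\min\{H_b(q_1),H_b(q_2)\}$. -/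

import Mathlib

open Filter Topology

noncomputable section

namespace DirtyMAC

/-- The binary entropy function, in bits. -/
def Hb (x : ℝ) : ℝ := -x * Real.logb 2 x - (1 - x) * Real.logb 2 (1 - x)

/-- The probability mass function of a Bernoulli(1/2) bit. -/
def bernoulliHalf : ZMod 2 → ℝ := fun _ => 1 / 2

/-- The probability mass function of a vector of `n` i.i.d. Bernoulli(1/2) bits. -/
def iidHalf {n : ℕ} (s : Fin n → ZMod 2) : ℝ := ∏ i, bernoulliHalf (s i)

/-- The input constraint `(1/n) w_H(x) ≤ q`. -/
def WeightLE {n : ℕ} (q : ℝ) (x : Fin n → ZMod 2) : Prop := (hammingNorm x : ℝ) / n ≤ q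

/-- The rate `(1/n) log₂ M` of a set of `M` messages at block length `n`. -/
def rate (n M : ℕ) : ℝ := Real.logb 2 M / n

/-! ### The binary MAC with one dirty user, common message -/

/-- A block code of length `n` with `M` common messages for `Y = X₁ ⊕ X₂ ⊕ S₁`:
both encoders know the message, only encoder 1 knows (non-causally) the interference vector. -/
structure OneDirtyCode (n M : ℕ) (q₁ q₂ : ℝ) where
  enc₁ : Fin M → (Fin n → ZMod 2) → (Fin n → ZMod 2)
  enc₂ : Fin M → (Fin n → ZMod 2)
  dec : (Fin n → ZMod 2) → Fin M
  weight₁ : ∀ w s, WeightLE q₁ (enc₁ w s)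
  weight₂ : ∀ w, WeightLE q₂ (enc₂ w)

/-- The probability of a decoding error, for a uniform message and an independent i.i.d.
Bernoulli(1/2) interference vector. -/
def OneDirtyCode.errorProb {n M : ℕ} {q₁ q₂ : ℝ} (c : OneDirtyCode n M q₁ q₂) : ℝ :=
  ∑ w : Fin M, ∑ s : Fin n → ZMod 2,
    (1 / (M : ℝ)) * iidHalf s * (if c.dec (c.enc₁ w s + c.enc₂ w + s) ≠ w then 1 else 0)

/-- `R` is an achievable common-message rate: there are codes of every block length `n`, of rate
at least `R` for all large `n`, whose error probabilities tend to zero. -/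
def OneDirtyAchievable (q₁ q₂ R : ℝ) : Prop :=
  ∃ (M : ℕ → ℕ) (c : ∀ n, OneDirtyCode n (M n) q₁ q₂),
    (∀ᶠ n in atTop, R ≤ rate n (M n)) ∧ Tendsto (fun n => (c n).errorProb) atTop (𝓝 0)

/-! ### The single-letter expression -/

/-- The distribution of the random variable `A` under the mass function `p` on `Ω`. -/
def law {Ω α : Type} [Fintype Ω] [DecidableEq α] (p : Ω → ℝ) (A : Ω → α) (a : α) : ℝ :=
  ∑ ω, if A ω = a then p ω else 0

/-- The Shannon entropy `H(A)`, in bits. -/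
def entropy {Ω α : Type} [Fintype Ω] [Fintype α] [DecidableEq α] (p : Ω → ℝ) (A : Ω → α) : ℝ :=
  -∑ a, law p A a * Real.logb 2 (law p A a)

/-- The mutual information `I(A;B) = H(A) + H(B) - H(A,B)`, in bits. -/
def mutualInfo {Ω α β : Type} [Fintype Ω] [Fintype α] [DecidableEq α] [Fintype β] [DecidableEq β]
    (p : Ω → ℝ) (A : Ω → α) (B : Ω → β) : ℝ :=
  entropy p A + entropy p B - entropy p (fun ω => (A ω, B ω))

/-- An outcome `(s₁, x₂, u₁, x₁)`; the output `y` is a function of it. -/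
abbrev Outcome (k : ℕ) : Type := ZMod 2 × ZMod 2 × Fin k × ZMod 2

/-- The interference bit `S₁`. -/
def rvS₁ {k : ℕ} (ω : Outcome k) : ZMod 2 := ω.1

/-- The input `X₂` of user 2. -/
def rvX₂ {k : ℕ} (ω : Outcome k) : ZMod 2 := ω.2.1

/-- The auxiliary variable `U₁`. -/
def rvU₁ {k : ℕ} (ω : Outcome k) : Fin k := ω.2.2.1

/-- The input `X₁` of user 1. -/
def rvX₁ {k : ℕ} (ω : Outcome k) : ZMod 2 := ω.2.2.2

/-- The channel output `Y = X₁ ⊕ X₂ ⊕ S₁`. -/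
def rvY {k : ℕ} (ω : Outcome k) : ZMod 2 := rvX₁ ω + rvX₂ ω + rvS₁ ω

/-- The freely chosen factors `P(x₂)`, `P(u₁|x₂,s₁)`, `P(x₁|s₁,u₁)` of the joint distribution,
for an auxiliary variable `U₁` with `k` values. -/
structure TestChannel (k : ℕ) where
  pX₂ : stdSimplex ℝ (ZMod 2)
  pU₁ : ZMod 2 → ZMod 2 → stdSimplex ℝ (Fin k)
  pX₁ : ZMod 2 → Fin k → stdSimplex ℝ (ZMod 2)

/-- The joint mass function `P(s₁) P(x₂) P(u₁|x₂,s₁) P(x₁|s₁,u₁)`. -/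
def TestChannel.joint {k : ℕ} (t : TestChannel k) (ω : Outcome k) : ℝ :=
  bernoulliHalf (rvS₁ ω) * (t.pX₂ : ZMod 2 → ℝ) (rvX₂ ω) *
    (t.pU₁ (rvX₂ ω) (rvS₁ ω) : Fin k → ℝ) (rvU₁ ω) *
    (t.pX₁ (rvS₁ ω) (rvU₁ ω) : ZMod 2 → ℝ) (rvX₁ ω)

/-- The objective `I(U₁,X₂;Y) - I(U₁,X₂;S₁)`. -/
def TestChannel.value {k : ℕ} (t : TestChannel k) : ℝ :=
  mutualInfo t.joint (fun ω => (rvU₁ ω, rvX₂ ω)) rvY -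
    mutualInfo t.joint (fun ω => (rvU₁ ω, rvX₂ ω)) rvS₁

/-- The input constraints `E X₁ ≤ q₁` and `E X₂ ≤ q₂` (where `E Xᵢ = P(Xᵢ = 1)`). -/
def TestChannel.Admissible {k : ℕ} (t : TestChannel k) (q₁ q₂ : ℝ) : Prop :=
  law t.joint rvX₁ 1 ≤ q₁ ∧ law t.joint rvX₂ 1 ≤ q₂

/-- All values of the objective, over all finite auxiliary alphabets and all admissible joint
distributions. -/
def singleLetterValues (q₁ q₂ : ℝ) : Set ℝ :=
  {r | ∃ (k : ℕ) (t : TestChannel k), t.Admissible q₁ q₂ ∧ t.value = r}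

/-! ### The binary doubly-dirty MAC, individual messages -/

/-- A block code of length `n` for `Y = X₁ ⊕ X₂ ⊕ S₁ ⊕ S₂`: encoder `i` knows only its own
message and its own interference vector. -/
structure DoublyDirtyCode (n M₁ M₂ : ℕ) (q₁ q₂ : ℝ) where
  enc₁ : Fin M₁ → (Fin n → ZMod 2) → (Fin n → ZMod 2)
  enc₂ : Fin M₂ → (Fin n → ZMod 2) → (Fin n → ZMod 2)
  dec : (Fin n → ZMod 2) → Fin M₁ × Fin M₂
  weight₁ : ∀ w s, WeightLE q₁ (enc₁ w s)
  weight₂ : ∀ w s, WeightLE q₂ (enc₂ w s)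

/-- The probability that the decoded message pair is wrong, for independent uniform messages and
independent i.i.d. Bernoulli(1/2) interference vectors. -/
def DoublyDirtyCode.errorProb {n M₁ M₂ : ℕ} {q₁ q₂ : ℝ} (c : DoublyDirtyCode n M₁ M₂ q₁ q₂) : ℝ :=
  ∑ w₁ : Fin M₁, ∑ w₂ : Fin M₂, ∑ s₁ : Fin n → ZMod 2, ∑ s₂ : Fin n → ZMod 2,
    (1 / (M₁ : ℝ)) * (1 / (M₂ : ℝ)) * iidHalf s₁ * iidHalf s₂ *
      (if c.dec (c.enc₁ w₁ s₁ + c.enc₂ w₂ s₂ + s₁ + s₂) ≠ (w₁, w₂) then 1 else 0)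

/-- `(R₁, R₂)` is an achievable rate pair for individual messages. -/
def DoublyDirtyAchievable (q₁ q₂ R₁ R₂ : ℝ) : Prop :=
  ∃ (M₁ M₂ : ℕ → ℕ) (c : ∀ n, DoublyDirtyCode n (M₁ n) (M₂ n) q₁ q₂),
    (∀ᶠ n in atTop, R₁ ≤ rate n (M₁ n)) ∧ (∀ᶠ n in atTop, R₂ ≤ rate n (M₂ n)) ∧
      Tendsto (fun n => (c n).errorProb) atTop (𝓝 0)

end DirtyMAC

end

/-!
The operational results rest on the volume `V` of the Hamming ball of radius `q₁ n`, which is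
`2 ^ (n Hb q₁)` up to a polynomial factor (`card_hammingBall_le`,
`two_rpow_Hb_le_card_hammingBall`).

For the converses no information inequality is needed. When decoding succeeds, the output `y`
determines the messages, and then `y` and `x₁` (and `s₂`, in the doubly-dirty case) determine the
uniform interference vector `s₁`. As `x₁` lies in the Hamming ball, counting the successful
realizations shows that the success probability is at most `V` divided by the total number of
messages (`OneDirtyCode.one_sub_errorProb_mul_le`, `DoublyDirtyCode.one_sub_errorProb_mul_le`).
Exchanging the users gives the bound with `q₂`.

For achievability user 2 stays silent and the binary vectors are partitioned at random into `M`
bins. User 1 moves `s₁` to a point of the bin of the message within distance `q₁ n`. The ball around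
`s₁` misses that bin with probability `(1 - 1 / M) ^ V ≤ exp (-V / M)`, which tends to `0` when
`M` is about `2 ^ (n R)` with `R < Hb q₁` (`exists_code_errorProb_le`,
`tendsto_card_hammingBall_div`).

In the single-letter expression the entropy of `(U₁, X₂)` cancels, leaving
`H(Y) - 1 + H(U₁, X₂, S₁) - H(U₁, X₂, Y)`. Since `S₁ = X₁ + X₂ + Y`, the difference of the last
two terms is at most `H(X₁) ≤ Hb q₁`, while `H(Y) ≤ 1` (`TestChannel.value_le`). Equality holds for
`X₂ = 0` and `U₁ = X₁ + S₁` with `X₁` a Bernoulli(`q₁`) bit independent of `S₁`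
(`le_value_optimalChannel`).
-/

noncomputable section

namespace DirtyMAC

open Finset

/-! ### The binary entropy function -/

theorem Hb_eq_binEntropy_div (x : ℝ) : Hb x = Real.binEntropy x / Real.log 2 := by
  simp only [Hb, Real.binEntropy, Real.logb, Real.log_inv]
  ring

theorem Hb_continuous : Continuous Hb := by
  rw [funext Hb_eq_binEntropy_div]
  fun_prop

theorem Hb_le_one (x : ℝ) : Hb x ≤ 1 := by
  rw [Hb_eq_binEntropy_div, div_le_one (Real.log_pos one_lt_two)]
  exact Real.binEntropy_le_log_two

theorem Hb_mono {x y : ℝ} (h0 : 0 ≤ x) (hxy : x ≤ y) (hy : y ≤ 1 / 2) : Hb x ≤ Hb y := by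
  rw [Hb_eq_binEntropy_div, Hb_eq_binEntropy_div]
  refine div_le_div_of_nonneg_right ?_ (Real.log_nonneg one_le_two)
  exact Real.binEntropy_strictMonoOn.monotoneOn ⟨h0, by linarith⟩ ⟨by linarith, by linarith⟩ hxy

theorem two_rpow_Hb (a x : ℝ) : (2 : ℝ) ^ (a * Hb x) = Real.exp (a * Real.binEntropy x) := by
  have h : Real.log 2 ≠ 0 := (Real.log_pos one_lt_two).ne'
  rw [Real.rpow_def_of_pos two_pos, Hb_eq_binEntropy_div]
  congr 1
  field_simp

/-! ### Volume of Hamming balls -/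

open Classical in
/-- The set of vectors satisfying the input constraint, i.e. the Hamming ball of radius `q n`
around `0`. -/
def hammingBall (n : ℕ) (q : ℝ) : Finset (Fin n → ZMod 2) := univ.filter (WeightLE q)

theorem mem_hammingBall {n : ℕ} {q : ℝ} {x : Fin n → ZMod 2} :
    x ∈ hammingBall n q ↔ WeightLE q x := by
  simp [hammingBall]

theorem WeightLE.hammingNorm_le {n : ℕ} {q : ℝ} {x : Fin n → ZMod 2} (h : WeightLE q x) :
    (hammingNorm x : ℝ) ≤ n * q := by
  rcases Nat.eq_zero_or_pos n with rfl | hn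
  · simp [hammingNorm]
  · have hn' : (0 : ℝ) < n := by exact_mod_cast hn
    have := (div_le_iff₀ hn').1 h
    linarith

theorem weightLE_zero {n : ℕ} {q : ℝ} (hq : 0 ≤ q) : WeightLE q (0 : Fin n → ZMod 2) := by
  simpa [WeightLE] using hq

theorem sum_zmod_two {A : Type*} [AddCommMonoid A] (f : ZMod 2 → A) : ∑ b, f b = f 0 + f 1 :=
  Fin.sum_univ_two f

/-- The probability of `x` under i.i.d. Bernoulli(`q`) bits. -/
theorem prod_bernoulli_eq {n : ℕ} (q : ℝ) (x : Fin n → ZMod 2) :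
    ∏ i, (if x i = 0 then 1 - q else q) =
      q ^ hammingNorm x * (1 - q) ^ (n - hammingNorm x) := by
  rw [prod_ite, prod_const, prod_const, mul_comm]
  have h := card_filter_add_card_filter_not (s := (univ : Finset (Fin n))) (fun i => x i = 0)
  rw [card_univ, Fintype.card_fin] at h
  have h2 : hammingNorm x = #{i | ¬ x i = 0} := rfl
  rw [h2]
  congr 2
  omega

theorem sum_bernoulli_eq_one (n : ℕ) (q : ℝ) :
    ∑ x : Fin n → ZMod 2, q ^ hammingNorm x * (1 - q) ^ (n - hammingNorm x) = 1 := by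
  simp_rw [← prod_bernoulli_eq]
  have h := (Finset.prod_univ_sum (fun _ : Fin n => (univ : Finset (ZMod 2)))
    (fun _ b => if b = 0 then 1 - q else q)).symm
  rw [Fintype.piFinset_univ] at h
  rw [h]
  refine prod_eq_one fun i _ => ?_
  simp [sum_zmod_two]

theorem hammingNorm_le_length {n : ℕ} (x : Fin n → ZMod 2) : hammingNorm x ≤ n := by
  simpa using hammingNorm_le_card_fintype (x := x)

/-- Inside the ball of radius `q n`, a vector of i.i.d. Bernoulli(`q`) bits has probability at
least that of the vectors on the boundary. -/
theorem exp_neg_le_bernoulli {n : ℕ} {q : ℝ} (h0 : 0 ≤ q) (h1 : q ≤ 1 / 2)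
    {x : Fin n → ZMod 2} (hx : WeightLE q x) :
    Real.exp (-(n * Real.binEntropy q)) ≤ q ^ hammingNorm x * (1 - q) ^ (n - hammingNorm x) := by
  have hw := hx.hammingNorm_le
  rcases h0.eq_or_lt with rfl | hq
  · have : hammingNorm x = 0 := by
      have : (hammingNorm x : ℝ) ≤ 0 := by simpa using hw
      exact_mod_cast this.antisymm (Nat.cast_nonneg _)
    simp [this]
  have hq' : 0 < 1 - q := by linarith
  rw [← Real.le_log_iff_exp_le (by positivity),
    Real.log_mul (by positivity) (by positivity), Real.log_pow, Real.log_pow,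
    Nat.cast_sub (hammingNorm_le_length x)]
  have hl : Real.log q ≤ Real.log (1 - q) := Real.log_le_log hq (by linarith)
  simp only [Real.binEntropy, Real.log_inv]
  nlinarith [mul_nonneg (sub_nonneg.2 hw) (sub_nonneg.2 hl)]

theorem card_hammingBall_le (n : ℕ) {q : ℝ} (h0 : 0 ≤ q) (h1 : q ≤ 1 / 2) :
    (#(hammingBall n q) : ℝ) ≤ 2 ^ (n * Hb q) := by
  have hq' : 0 ≤ 1 - q := by linarith
  have h : ∑ _x ∈ hammingBall n q, Real.exp (-(n * Real.binEntropy q)) ≤ 1 := by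
    rw [← sum_bernoulli_eq_one n q]
    refine (sum_le_sum fun x hx => exp_neg_le_bernoulli h0 h1 (mem_hammingBall.1 hx)).trans ?_
    exact sum_le_sum_of_subset_of_nonneg (subset_univ _) fun x _ _ => by positivity
  rw [sum_const, nsmul_eq_mul, Real.exp_neg, mul_inv_le_iff₀ (Real.exp_pos _), one_mul] at h
  rwa [two_rpow_Hb]

/-- The terms of the binomial expansion of `(k + (n - k)) ^ n` increase up to the `k`-th one and
decrease afterwards. -/
theorem binomial_term_le {n k : ℕ} (hk : k ≤ n) (j : ℕ) :
    n.choose j * k ^ j * (n - k) ^ (n - j) ≤ n.choose k * k ^ k * (n - k) ^ (n - k) := by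
  have step (j : ℕ) (hj : j < n) :
      (j + 1) * (n.choose (j + 1) * k ^ (j + 1) * (n - k) ^ (n - (j + 1))) =
          ((n - j) * k) * (n.choose j * k ^ j * (n - k) ^ (n - (j + 1))) ∧
        (j + 1) * (n.choose j * k ^ j * (n - k) ^ (n - j)) =
          ((j + 1) * (n - k)) * (n.choose j * k ^ j * (n - k) ^ (n - (j + 1))) := by
    have h := Nat.choose_succ_right_eq n j
    constructor
    · calc _ = (n.choose (j + 1) * (j + 1)) * k ^ (j + 1) * (n - k) ^ (n - (j + 1)) := by ring
        _ = _ := by rw [h]; ring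
    · rw [show n - j = (n - (j + 1)) + 1 by omega]
      ring
  have up (j : ℕ) (hj : j < k) : n.choose j * k ^ j * (n - k) ^ (n - j) ≤
      n.choose (j + 1) * k ^ (j + 1) * (n - k) ^ (n - (j + 1)) := by
    obtain ⟨h1, h2⟩ := step j (by omega)
    refine le_of_mul_le_mul_left (a := j + 1) ?_ j.succ_pos
    rw [h1, h2, mul_comm (n - j) k]
    gcongr
    omega
  have down (j : ℕ) (hj : k ≤ j) : n.choose (j + 1) * k ^ (j + 1) * (n - k) ^ (n - (j + 1)) ≤
      n.choose j * k ^ j * (n - k) ^ (n - j) := by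
    rcases lt_or_ge j n with hjn | hjn
    · obtain ⟨h1, h2⟩ := step j hjn
      refine le_of_mul_le_mul_left (a := j + 1) ?_ j.succ_pos
      rw [h1, h2, mul_comm (n - j) k]
      gcongr
      omega
    · simp [Nat.choose_eq_zero_of_lt (Nat.lt_succ_of_le hjn)]
  rcases le_total j k with hj | hj
  · have h (d : ℕ) (hd : d ≤ k) : n.choose (k - d) * k ^ (k - d) * (n - k) ^ (n - (k - d)) ≤
        n.choose k * k ^ k * (n - k) ^ (n - k) := by
      induction d with
      | zero => simp
      | succ d ih =>
        have := up (k - (d + 1)) (by omega)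
        rw [show k - (d + 1) + 1 = k - d by omega] at this
        exact this.trans (ih (by omega))
    simpa [Nat.sub_sub_self hj] using h (k - j) (by omega)
  · induction j, hj using Nat.le_induction with
    | base => exact le_rfl
    | succ j hj ih => exact (down j hj).trans ih

theorem pow_self_le_choose_mul {n k : ℕ} (hk : k ≤ n) :
    n ^ n ≤ (n + 1) * (n.choose k * k ^ k * (n - k) ^ (n - k)) := by
  have h := add_pow k (n - k) n
  rw [Nat.add_sub_cancel' hk] at h
  calc n ^ n = ∑ j ∈ range (n + 1), n.choose j * k ^ j * (n - k) ^ (n - j) := by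
        rw [h]
        exact sum_congr rfl fun j _ => by simp; ring
    _ ≤ ∑ _j ∈ range (n + 1), n.choose k * k ^ k * (n - k) ^ (n - k) :=
        sum_le_sum fun j _ => binomial_term_le hk j
    _ = _ := by simp

theorem two_rpow_Hb_le_choose {n k : ℕ} (hn : 0 < n) (hk : k ≤ n) :
    (2 : ℝ) ^ (n * Hb ((k : ℝ) / n)) ≤ (n + 1) * n.choose k := by
  have hn' : (n : ℝ) ≠ 0 := by exact_mod_cast hn.ne'
  have hkk : (0 : ℝ) < (k : ℝ) ^ k := by exact_mod_cast Nat.pow_self_pos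
  have hmm : (0 : ℝ) < ((n - k : ℕ) : ℝ) ^ (n - k) := by exact_mod_cast Nat.pow_self_pos
  have hnn : (0 : ℝ) < (n : ℝ) ^ n := by positivity
  have hent : n * Real.binEntropy ((k : ℝ) / n) =
      n * Real.log n - k * Real.log k - (n - k : ℕ) * Real.log (n - k : ℕ) := by
    have h1 : 1 - (k : ℝ) / n = ((n - k : ℕ) : ℝ) / n := by
      rw [Nat.cast_sub hk]
      field_simp
    -- The junk value `log 0 = 0` makes this hold for `a = 0` too.
    have h2 (a : ℝ) : n * (a / n * Real.log (a / n)) = a * Real.log a - a * Real.log n := by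
      rcases eq_or_ne a 0 with rfl | ha
      · simp
      · rw [Real.log_div ha hn']
        field_simp
    have h3 := h2 k
    have h4 := h2 (n - k : ℕ)
    have h5 : (((n - k : ℕ) : ℝ)) = n - k := Nat.cast_sub hk
    simp only [Real.binEntropy, Real.log_inv, h1]
    linear_combination -h3 - h4 + Real.log n * h5
  have hexp : Real.exp (n * Real.binEntropy ((k : ℝ) / n)) *
      ((k : ℝ) ^ k * ((n - k : ℕ) : ℝ) ^ (n - k)) = (n : ℝ) ^ n := by
    rw [← Real.exp_log hkk, ← Real.exp_log hmm, ← Real.exp_log hnn, ← Real.exp_add, ← Real.exp_add,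
      hent, Real.log_pow, Real.log_pow, Real.log_pow]
    congr 1
    ring
  rw [two_rpow_Hb]
  refine le_of_mul_le_mul_right ?_ (mul_pos hkk hmm)
  rw [hexp]
  calc (n : ℝ) ^ n ≤ (n + 1) * (n.choose k * (k : ℝ) ^ k * ((n - k : ℕ) : ℝ) ^ (n - k)) := by
        exact_mod_cast pow_self_le_choose_mul hk
    _ = _ := by ring

theorem choose_le_card_hammingBall {n k : ℕ} {q : ℝ} (hk : (k : ℝ) / n ≤ q) :
    n.choose k ≤ #(hammingBall n q) := by
  calc n.choose k = #(powersetCard k (univ : Finset (Fin n))) := by simp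
    _ ≤ _ := by
      refine card_le_card_of_injOn (fun s i => if i ∈ s then 1 else 0) (fun s hs => ?_) ?_
      · rw [mem_coe, mem_powersetCard] at hs
        have : hammingNorm (fun i : Fin n => if i ∈ s then (1 : ZMod 2) else 0) = k := by
          simp [hammingNorm, hs.2]
        rw [mem_coe, mem_hammingBall, WeightLE, this]
        exact hk
      · intro s _ t _ hst
        ext i
        have := congrFun hst i
        by_cases h1 : i ∈ s <;> by_cases h2 : i ∈ t <;> simp_all

/-- The volume of a Hamming ball, up to a polynomial factor. -/
theorem two_rpow_Hb_le_card_hammingBall {n : ℕ} {q : ℝ} (hn : 0 < n) (h0 : 0 ≤ q) (h1 : q ≤ 1) :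
    (2 : ℝ) ^ (n * Hb ((⌊q * n⌋₊ : ℝ) / n)) ≤ (n + 1) * #(hammingBall n q) := by
  have hn' : (0 : ℝ) < n := by exact_mod_cast hn
  have hfl : (⌊q * n⌋₊ : ℝ) ≤ q * n := Nat.floor_le (by positivity)
  have hk : ⌊q * n⌋₊ ≤ n := by
    have : (⌊q * n⌋₊ : ℝ) ≤ n := hfl.trans (by nlinarith)
    exact_mod_cast this
  refine (two_rpow_Hb_le_choose hn hk).trans ?_
  gcongr
  exact choose_le_card_hammingBall ((div_le_iff₀ hn').2 hfl)

/-! ### Converse: counting correctly decoded interference vectors -/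

theorem iidHalf_eq {n : ℕ} (s : Fin n → ZMod 2) : iidHalf s = (1 / 2 : ℝ) ^ n := by
  simp [iidHalf, bernoulliHalf]

theorem card_binary_vector (n : ℕ) : Fintype.card (Fin n → ZMod 2) = 2 ^ n := by
  simp [ZMod.card]

theorem one_sub_sum_uniform_eq {Ω : Type*} [Fintype Ω] (p : Ω → Prop) [DecidablePred p] {a : ℝ}
    (ha : a * Fintype.card Ω = 1) :
    1 - ∑ ω, a * (if ¬ p ω then 1 else 0) = a * #{ω | p ω} := by
  rw [← mul_sum, sum_boole, ← ha, ← card_univ,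
    ← card_filter_add_card_filter_not (s := (univ : Finset Ω)) p]
  push_cast
  ring

theorem OneDirtyCode.pos {n M : ℕ} {q₁ q₂ : ℝ} (c : OneDirtyCode n M q₁ q₂) : 0 < M :=
  (c.dec 0).pos

theorem DoublyDirtyCode.pos {n M₁ M₂ : ℕ} {q₁ q₂ : ℝ} (c : DoublyDirtyCode n M₁ M₂ q₁ q₂) :
    0 < M₁ ∧ 0 < M₂ :=
  ⟨(c.dec 0).1.pos, (c.dec 0).2.pos⟩

/-- If decoding succeeds, the output determines the message, and the output together with
`x₁` then determines the interference vector; so there are at most `2 ^ n` times the volume of the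
Hamming ball many pairs `(w, s)` for which decoding succeeds. -/
theorem OneDirtyCode.one_sub_errorProb_mul_le {n M : ℕ} {q₁ q₂ : ℝ} (c : OneDirtyCode n M q₁ q₂) :
    (1 - c.errorProb) * M ≤ #(hammingBall n q₁) := by
  have hM : (0 : ℝ) < M := by exact_mod_cast c.pos
  let p : Fin M × (Fin n → ZMod 2) → Prop := fun ω =>
    c.dec (c.enc₁ ω.1 ω.2 + c.enc₂ ω.1 + ω.2) = ω.1
  have herr : c.errorProb = ∑ ω, (1 / (M : ℝ)) * (1 / 2) ^ n * (if ¬ p ω then 1 else 0) := by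
    simp only [OneDirtyCode.errorProb, iidHalf_eq, Fintype.sum_prod_type, p, ne_eq]
  have hcard : #{ω | p ω} ≤ 2 ^ n * #(hammingBall n q₁) := by
    rw [← card_binary_vector, ← card_univ, ← card_product]
    refine card_le_card_of_injOn
      (fun ω => (c.enc₁ ω.1 ω.2 + c.enc₂ ω.1 + ω.2, c.enc₁ ω.1 ω.2)) (fun ω _ => ?_) ?_
    · simpa [mem_hammingBall] using c.weight₁ _ _
    · rintro ⟨w, s⟩ h ⟨w', s'⟩ h' heq
      simp only [coe_filter, mem_univ, true_and, Set.mem_ofPred_eq, p] at h h'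
      obtain ⟨hy, hx⟩ := Prod.mk.inj heq
      dsimp only at hy hx
      have hw : w = w' := by rw [← h, ← h', hy]
      subst hw
      rw [hx] at hy
      rw [add_left_cancel hy]
  have h := one_sub_sum_uniform_eq p (a := (1 / (M : ℝ)) * (1 / 2) ^ n) (by
    rw [Fintype.card_prod, card_binary_vector, Fintype.card_fin]
    push_cast
    field_simp
    simp)
  rw [← herr] at h
  have hcard' : (#{ω | p ω} : ℝ) ≤ 2 ^ n * #(hammingBall n q₁) := by exact_mod_cast hcard
  calc (1 - c.errorProb) * M = (1 / 2) ^ n * #{ω | p ω} := by rw [h]; field_simp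
    _ ≤ (1 / 2) ^ n * (2 ^ n * #(hammingBall n q₁)) := by gcongr
    _ = _ := by rw [← mul_assoc, ← mul_pow]; norm_num

/-- If decoding succeeds, the output determines both messages; together with `s₂` and `x₁` it then
determines `s₁`. -/
theorem DoublyDirtyCode.one_sub_errorProb_mul_le {n M₁ M₂ : ℕ} {q₁ q₂ : ℝ}
    (c : DoublyDirtyCode n M₁ M₂ q₁ q₂) :
    (1 - c.errorProb) * (M₁ * M₂ : ℕ) ≤ #(hammingBall n q₁) := by
  have hM₁ : (0 : ℝ) < M₁ := by exact_mod_cast c.pos.1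
  have hM₂ : (0 : ℝ) < M₂ := by exact_mod_cast c.pos.2
  let V := Fin n → ZMod 2
  let y : Fin M₁ × Fin M₂ × V × V → V := fun ω =>
    c.enc₁ ω.1 ω.2.2.1 + c.enc₂ ω.2.1 ω.2.2.2 + ω.2.2.1 + ω.2.2.2
  let p : Fin M₁ × Fin M₂ × V × V → Prop := fun ω => c.dec (y ω) = (ω.1, ω.2.1)
  let a : ℝ := (1 / (M₁ : ℝ)) * (1 / (M₂ : ℝ)) * (1 / 2) ^ n * (1 / 2) ^ n
  have herr : c.errorProb = ∑ ω, a * (if ¬ p ω then 1 else 0) := by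
    simp only [DoublyDirtyCode.errorProb, iidHalf_eq, Fintype.sum_prod_type, p, ne_eq, a, y, V]
  have hcard : #{ω | p ω} ≤ 2 ^ n * (2 ^ n * #(hammingBall n q₁)) := by
    rw [← card_binary_vector, ← card_univ, ← card_product, ← card_product]
    refine card_le_card_of_injOn (fun ω => (y ω, ω.2.2.2, c.enc₁ ω.1 ω.2.2.1)) (fun ω _ => ?_) ?_
    · simpa [mem_hammingBall] using c.weight₁ _ _
    · rintro ⟨w₁, w₂, s₁, s₂⟩ h ⟨w₁', w₂', s₁', s₂'⟩ h' heq
      simp only [coe_filter, mem_univ, true_and, Set.mem_ofPred_eq, p] at h h'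
      obtain ⟨hy, heq'⟩ := Prod.mk.inj heq
      obtain ⟨hs, hx⟩ := Prod.mk.inj heq'
      dsimp only at hs hx
      have hw : (w₁, w₂) = (w₁', w₂') := by rw [← h, ← h', hy]
      obtain ⟨rfl, rfl⟩ := Prod.mk.inj hw
      subst hs
      simp only [y] at hy
      rw [hx] at hy
      rw [add_left_cancel (add_right_cancel hy)]
  have h := one_sub_sum_uniform_eq p (a := a) (by
    simp only [Fintype.card_prod, card_binary_vector, Fintype.card_fin, a, V]
    push_cast
    field_simp
    simp)
  rw [← herr] at h
  have hcard' : (#{ω | p ω} : ℝ) ≤ 2 ^ n * (2 ^ n * #(hammingBall n q₁)) := by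
    exact_mod_cast hcard
  have hhalf : (1 / 2 : ℝ) ^ n * 2 ^ n = 1 := by rw [← mul_pow]; norm_num
  calc (1 - c.errorProb) * (M₁ * M₂ : ℕ) = (1 / 2) ^ n * (1 / 2) ^ n * #{ω | p ω} := by
        rw [h]
        simp only [a]
        push_cast
        field_simp
    _ ≤ (1 / 2) ^ n * (1 / 2) ^ n * (2 ^ n * (2 ^ n * #(hammingBall n q₁))) := by gcongr
    _ = ((1 / 2) ^ n * 2 ^ n) * ((1 / 2) ^ n * 2 ^ n) * #(hammingBall n q₁) := by ring
    _ = _ := by rw [hhalf, one_mul, one_mul]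

theorem rate_mul {n M₁ M₂ : ℕ} (h₁ : 0 < M₁) (h₂ : 0 < M₂) :
    rate n (M₁ * M₂) = rate n M₁ + rate n M₂ := by
  rw [rate, rate, rate, Nat.cast_mul, Real.logb_mul (by positivity) (by positivity), add_div]

/-- A success probability bounded by `2 ^ (n H) / M` and tending to `1` limits the rate to `H`. -/
theorem le_of_one_sub_mul_le {R H : ℝ} {M : ℕ → ℕ} {e : ℕ → ℝ} (hM : ∀ n, 0 < M n)
    (hR : ∀ᶠ n in atTop, R ≤ rate n (M n)) (he : Tendsto e atTop (𝓝 0))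
    (h : ∀ n, (1 - e n) * M n ≤ 2 ^ (n * H)) : R ≤ H := by
  have hlim : Tendsto (fun n : ℕ => H + 1 / (n : ℝ)) atTop (𝓝 (H + 0)) :=
    tendsto_const_nhds.add tendsto_one_div_atTop_nhds_zero_nat
  rw [add_zero] at hlim
  refine ge_of_tendsto hlim ?_
  filter_upwards [hR, he.eventually (gt_mem_nhds (show (0 : ℝ) < 1 / 2 by norm_num)),
    eventually_gt_atTop 0] with n hn hen hn0
  refine hn.trans ?_
  have hn' : (0 : ℝ) < n := by exact_mod_cast hn0
  have hMn : (0 : ℝ) < M n := by exact_mod_cast hM n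
  have hle : (M n : ℝ) ≤ 2 ^ (n * H + 1) := by
    rw [Real.rpow_add two_pos, Real.rpow_one]
    nlinarith [h n]
  have hlog : Real.logb 2 (M n) ≤ n * H + 1 := (Real.logb_le_iff_le_rpow one_lt_two hMn).2 hle
  rw [rate, div_le_iff₀ hn']
  calc _ ≤ n * H + 1 := hlog
    _ = _ := by field_simp

theorem OneDirtyAchievable.le_Hb {q₁ q₂ R : ℝ} (h0 : 0 ≤ q₁) (h1 : q₁ ≤ 1 / 2)
    (h : OneDirtyAchievable q₁ q₂ R) : R ≤ Hb q₁ := by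
  obtain ⟨M, c, hR, he⟩ := h
  exact le_of_one_sub_mul_le (fun n => (c n).pos) hR he fun n =>
    (c n).one_sub_errorProb_mul_le.trans (card_hammingBall_le n h0 h1)

theorem DoublyDirtyAchievable.add_le_Hb {q₁ q₂ R₁ R₂ : ℝ} (h0 : 0 ≤ q₁) (h1 : q₁ ≤ 1 / 2)
    (h : DoublyDirtyAchievable q₁ q₂ R₁ R₂) : R₁ + R₂ ≤ Hb q₁ := by
  obtain ⟨M₁, M₂, c, hR₁, hR₂, he⟩ := h
  refine le_of_one_sub_mul_le (M := fun n => M₁ n * M₂ n)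
    (fun n => Nat.mul_pos (c n).pos.1 (c n).pos.2) ?_ he fun n =>
    (c n).one_sub_errorProb_mul_le.trans (card_hammingBall_le n h0 h1)
  filter_upwards [hR₁, hR₂] with n h₁ h₂
  rw [rate_mul (c n).pos.1 (c n).pos.2]
  exact add_le_add h₁ h₂

/-- The code in which the two users exchange their roles. -/
def DoublyDirtyCode.swap {n M₁ M₂ : ℕ} {q₁ q₂ : ℝ} (c : DoublyDirtyCode n M₁ M₂ q₁ q₂) :
    DoublyDirtyCode n M₂ M₁ q₂ q₁ where
  enc₁ := c.enc₂
  enc₂ := c.enc₁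
  dec y := (c.dec y).swap
  weight₁ := c.weight₂
  weight₂ := c.weight₁

theorem DoublyDirtyCode.errorProb_swap {n M₁ M₂ : ℕ} {q₁ q₂ : ℝ}
    (c : DoublyDirtyCode n M₁ M₂ q₁ q₂) : c.swap.errorProb = c.errorProb := by
  simp only [DoublyDirtyCode.errorProb]
  rw [sum_comm]
  refine sum_congr rfl fun w₁ _ => sum_congr rfl fun w₂ _ => ?_
  rw [sum_comm]
  refine sum_congr rfl fun s₁ _ => sum_congr rfl fun s₂ _ => ?_
  have hy : c.swap.enc₁ w₂ s₂ + c.swap.enc₂ w₁ s₁ + s₂ + s₁ =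
      c.enc₁ w₁ s₁ + c.enc₂ w₂ s₂ + s₁ + s₂ := by
    simp only [DoublyDirtyCode.swap]
    abel
  have hw : c.swap.dec (c.swap.enc₁ w₂ s₂ + c.swap.enc₂ w₁ s₁ + s₂ + s₁) ≠ (w₂, w₁) ↔
      c.dec (c.enc₁ w₁ s₁ + c.enc₂ w₂ s₂ + s₁ + s₂) ≠ (w₁, w₂) := by
    rw [hy, ← Prod.swap_prod_mk]
    exact Prod.swap_injective.ne_iff
  rw [if_congr hw rfl rfl]
  ring

theorem DoublyDirtyAchievable.swap {q₁ q₂ R₁ R₂ : ℝ} (h : DoublyDirtyAchievable q₁ q₂ R₁ R₂) :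
    DoublyDirtyAchievable q₂ q₁ R₂ R₁ := by
  obtain ⟨M₁, M₂, c, hR₁, hR₂, he⟩ := h
  refine ⟨M₂, M₁, fun n => (c n).swap, hR₂, hR₁, ?_⟩
  simpa only [DoublyDirtyCode.errorProb_swap] using he

/-! ### Achievability: random binning -/

open Classical in
/-- The binning code of a partition `f` of the binary vectors into `M` bins: user 2 stays silent,
user 1 moves the interference vector `s` into the bin of the message by changing at most `q₁ n`
bits, if it can, and the decoder reads off the bin. -/
def binningCode {n M : ℕ} {q₁ q₂ : ℝ} (h₁ : 0 ≤ q₁) (h₂ : 0 ≤ q₂)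
    (f : (Fin n → ZMod 2) → Fin M) : OneDirtyCode n M q₁ q₂ where
  enc₁ w s := if h : ∃ x ∈ hammingBall n q₁, f (x + s) = w then h.choose else 0
  enc₂ _ := 0
  dec := f
  weight₁ w s := by
    split_ifs with h
    · exact mem_hammingBall.1 h.choose_spec.1
    · exact weightLE_zero h₁
  weight₂ _ := weightLE_zero h₂

open Classical in
theorem binningCode_errorProb_le {n M : ℕ} {q₁ q₂ : ℝ} (h₁ : 0 ≤ q₁) (h₂ : 0 ≤ q₂)
    (f : (Fin n → ZMod 2) → Fin M) :
    (binningCode h₁ h₂ f : OneDirtyCode n M q₁ q₂).errorProb ≤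
      ∑ w, ∑ s, (1 / (M : ℝ)) * (1 / 2) ^ n *
        (if ∀ x ∈ hammingBall n q₁, f (x + s) ≠ w then 1 else 0) := by
  simp only [OneDirtyCode.errorProb, iidHalf_eq]
  refine sum_le_sum fun w _ => sum_le_sum fun s _ => ?_
  refine mul_le_mul_of_nonneg_left ?_ (by positivity)
  split_ifs with hne hall
  · exact le_rfl
  · push Not at hall
    refine absurd ?_ hne
    simp only [binningCode, dif_pos hall, add_zero]
    exact hall.choose_spec.2
  · exact zero_le_one
  · exact le_rfl

open Classical in
/-- The number of partitions into `M` bins for which the bin of `w` misses the ball around `s`. -/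
theorem card_binning_missing {n M : ℕ} (B : Finset (Fin n → ZMod 2)) (w : Fin M)
    (s : Fin n → ZMod 2) :
    #{f : (Fin n → ZMod 2) → Fin M | ∀ x ∈ B, f (x + s) ≠ w} =
      (M - 1) ^ #B * M ^ (2 ^ n - #B) := by
  let B' := B.image (· + s)
  have hB' : #B' = #B := card_image_of_injective _ (add_left_injective s)
  have hset : ({f | ∀ x ∈ B, f (x + s) ≠ w} : Finset ((Fin n → ZMod 2) → Fin M)) =
      Fintype.piFinset fun z => if z ∈ B' then univ.erase w else univ := by
    ext f
    simp only [mem_filter, mem_univ, true_and, Fintype.mem_piFinset]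
    constructor
    · intro h z
      split_ifs with hz
      · obtain ⟨x, hx, rfl⟩ := mem_image.1 hz
        simpa using h x hx
      · exact mem_univ _
    · intro h x hx
      have := h (x + s)
      rw [if_pos (mem_image_of_mem _ hx)] at this
      exact (mem_erase.1 this).1
  rw [hset, Fintype.card_piFinset]
  simp only [apply_ite card, card_erase_of_mem (mem_univ w), card_univ, Fintype.card_fin]
  rw [prod_ite, prod_const, prod_const, filter_mem_eq_inter, univ_inter, filter_not,
    filter_mem_eq_inter, univ_inter, ← compl_eq_univ_sdiff, card_compl, hB', card_binary_vector]

/-- Averaging over all partitions into bins. -/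
theorem exists_code_errorProb_le (n : ℕ) {M : ℕ} {q₁ q₂ : ℝ} (h₁ : 0 ≤ q₁) (h₂ : 0 ≤ q₂)
    (hM : 0 < M) : ∃ c : OneDirtyCode n M q₁ q₂,
      c.errorProb ≤ Real.exp (-(#(hammingBall n q₁) / M)) := by
  classical
  set B := hammingBall n q₁
  have hM' : (0 : ℝ) < M := by exact_mod_cast hM
  have : Nonempty (Fin M) := ⟨⟨0, hM⟩⟩
  have hB : #B ≤ 2 ^ n := by
    rw [← card_binary_vector]
    exact card_le_univ B
  have havg : ((M - 1 : ℕ) ^ #B * M ^ (2 ^ n - #B) : ℝ) ≤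
      M ^ 2 ^ n * Real.exp (-(#B / M)) := by
    have h1 : ((M - 1 : ℕ) : ℝ) = M * (1 - 1 / M) := by
      rw [Nat.cast_sub hM]
      field_simp
      simp
    have h2 : (M : ℝ) ^ 2 ^ n = M ^ #B * M ^ (2 ^ n - #B) := by
      rw [← pow_add, Nat.add_sub_cancel' hB]
    have h3 : (1 - 1 / (M : ℝ)) ^ #B ≤ Real.exp (-(#B / M)) := by
      have h4 : 0 ≤ 1 - 1 / (M : ℝ) := by
        rw [sub_nonneg, div_le_one hM']
        exact_mod_cast hM
      calc _ ≤ Real.exp (-(1 / M)) ^ #B :=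
            pow_le_pow_left₀ h4 (by linarith [Real.add_one_le_exp (-(1 / (M : ℝ)))]) _
        _ = _ := by
            rw [← Real.exp_nat_mul]
            congr 1
            ring
    rw [h1, h2, mul_pow]
    calc _ = M ^ #B * M ^ (2 ^ n - #B) * (1 - 1 / (M : ℝ)) ^ #B := by ring
      _ ≤ _ := by gcongr
  have hsum : ∑ f : (Fin n → ZMod 2) → Fin M,
      (binningCode h₁ h₂ f : OneDirtyCode n M q₁ q₂).errorProb ≤
        ∑ _f : (Fin n → ZMod 2) → Fin M, Real.exp (-(#B / M)) := by
    calc _ ≤ ∑ f : (Fin n → ZMod 2) → Fin M, ∑ w, ∑ s, (1 / (M : ℝ)) * (1 / 2) ^ n *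
          (if ∀ x ∈ B, f (x + s) ≠ w then 1 else 0) :=
          sum_le_sum fun f _ => binningCode_errorProb_le h₁ h₂ f
      _ = ∑ w : Fin M, ∑ s : Fin n → ZMod 2, (1 / (M : ℝ)) * (1 / 2) ^ n *
          ((M - 1 : ℕ) ^ #B * M ^ (2 ^ n - #B)) := by
          rw [sum_comm]
          refine sum_congr rfl fun w _ => ?_
          rw [sum_comm]
          refine sum_congr rfl fun s _ => ?_
          rw [← mul_sum, sum_boole, card_binning_missing B w s]
          push_cast
          rfl
      _ = (M - 1 : ℕ) ^ #B * M ^ (2 ^ n - #B) := by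
          simp only [sum_const, card_univ, card_binary_vector, Fintype.card_fin, nsmul_eq_mul]
          push_cast
          rw [one_div_pow]
          field_simp
      _ ≤ _ := by
          rw [sum_const, card_univ, Fintype.card_fun, card_binary_vector, Fintype.card_fin,
            nsmul_eq_mul]
          exact_mod_cast havg
  obtain ⟨f, -, hf⟩ := exists_le_of_sum_le univ_nonempty hsum
  exact ⟨_, hf⟩

theorem OneDirtyCode.errorProb_nonneg {n M : ℕ} {q₁ q₂ : ℝ} (c : OneDirtyCode n M q₁ q₂) :
    0 ≤ c.errorProb := by
  simp only [OneDirtyCode.errorProb, iidHalf_eq]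
  exact sum_nonneg fun w _ => sum_nonneg fun s _ => by positivity

/-- Every rate below the entropy leaves exponentially many points of a Hamming ball per bin. -/
theorem tendsto_card_hammingBall_div {q R : ℝ} (h0 : 0 ≤ q) (h1 : q ≤ 1 / 2) (hR0 : 0 ≤ R)
    (hR : R < Hb q) :
    Tendsto (fun n : ℕ => (#(hammingBall n q) : ℝ) / ⌈(2 : ℝ) ^ (n * R)⌉₊) atTop atTop := by
  obtain ⟨R', hRR', hR'⟩ := exists_between hR
  have hδ : 1 < (2 : ℝ) ^ (R' - R) := Real.one_lt_rpow one_lt_two (sub_pos.2 hRR')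
  have hHb : ∀ᶠ n : ℕ in atTop, R' < Hb ((⌊q * n⌋₊ : ℝ) / n) :=
    ((Hb_continuous.tendsto q).comp
      ((tendsto_nat_floor_mul_div_atTop h0).comp tendsto_natCast_atTop_atTop)).eventually
      (lt_mem_nhds hR')
  -- `2 ^ (n (R' - R)) / (4 n)` tends to infinity and is a lower bound for large `n`.
  have hgrow : Tendsto (fun n : ℕ => ((n : ℝ) ^ 1 / ((2 : ℝ) ^ (R' - R)) ^ n)⁻¹ * (1 / 4))
      atTop atTop := by
    refine Tendsto.atTop_mul_const (by norm_num) (Tendsto.inv_tendsto_nhdsGT_zero ?_)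
    refine tendsto_nhdsWithin_iff.2 ⟨tendsto_pow_const_div_const_pow_of_one_lt 1 hδ, ?_⟩
    filter_upwards [eventually_gt_atTop 0] with n hn
    have : (0 : ℝ) < n := by exact_mod_cast hn
    exact Set.mem_Ioi.2 (by positivity)
  refine tendsto_atTop_mono' _ ?_ hgrow
  filter_upwards [hHb, eventually_gt_atTop 0] with n hn hn0
  have hn' : (1 : ℝ) ≤ n := by exact_mod_cast hn0
  have hpow : (1 : ℝ) ≤ 2 ^ (n * R) := Real.one_le_rpow one_le_two (by positivity)
  have hceil : (⌈(2 : ℝ) ^ (n * R)⌉₊ : ℝ) ≤ 2 * 2 ^ (n * R) := by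
    linarith [Nat.ceil_lt_add_one (zero_le_one.trans hpow)]
  have hceil0 : (0 : ℝ) < ⌈(2 : ℝ) ^ (n * R)⌉₊ := by
    exact_mod_cast Nat.ceil_pos.2 (by linarith)
  have hball : (2 : ℝ) ^ (n * R') ≤ 2 * n * #(hammingBall n q) := by
    calc (2 : ℝ) ^ (n * R') ≤ 2 ^ (n * Hb ((⌊q * n⌋₊ : ℝ) / n)) :=
          Real.rpow_le_rpow_of_exponent_le one_le_two (by gcongr)
      _ ≤ (n + 1) * #(hammingBall n q) :=
          two_rpow_Hb_le_card_hammingBall hn0 h0 (by linarith)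
      _ ≤ _ := by
          gcongr
          linarith
  have hsplit : ((2 : ℝ) ^ (R' - R)) ^ n * 2 ^ (n * R) = 2 ^ (n * R') := by
    rw [← Real.rpow_natCast, ← Real.rpow_mul two_pos.le, ← Real.rpow_add two_pos]
    congr 1
    ring
  rw [pow_one, inv_div, le_div_iff₀ hceil0]
  calc _ ≤ ((2 : ℝ) ^ (R' - R)) ^ n / n * (1 / 4) * (2 * 2 ^ (n * R)) := by gcongr
    _ = (((2 : ℝ) ^ (R' - R)) ^ n * 2 ^ (n * R)) / (2 * n) := by ring
    _ ≤ _ := by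
      rw [hsplit, div_le_iff₀ (by positivity)]
      linarith

theorem oneDirtyAchievable_of_lt {q₁ q₂ R : ℝ} (h₁ : 0 ≤ q₁) (h₁' : q₁ ≤ 1 / 2) (h₂ : 0 ≤ q₂)
    (hR0 : 0 ≤ R) (hR : R < Hb q₁) : OneDirtyAchievable q₁ q₂ R := by
  have hM (n : ℕ) : 0 < ⌈(2 : ℝ) ^ (n * R)⌉₊ := Nat.ceil_pos.2 (by positivity)
  choose c hc using fun n => exists_code_errorProb_le n (q₂ := q₂) h₁ h₂ (hM n)
  refine ⟨_, c, ?_, ?_⟩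
  · filter_upwards [eventually_gt_atTop 0] with n hn
    have hn' : (0 : ℝ) < n := by exact_mod_cast hn
    rw [rate, le_div_iff₀ hn', Real.le_logb_iff_rpow_le one_lt_two (by exact_mod_cast hM n),
      mul_comm]
    exact Nat.le_ceil _
  · refine squeeze_zero (fun n => (c n).errorProb_nonneg) hc ?_
    exact Real.tendsto_exp_neg_atTop_nhds_zero.comp (tendsto_card_hammingBall_div h₁ h₁' hR0 hR)

/-- A single message can be sent without error. -/
theorem oneDirtyAchievable_zero {q₁ q₂ : ℝ} (h₁ : 0 ≤ q₁) (h₂ : 0 ≤ q₂) :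
    OneDirtyAchievable q₁ q₂ 0 := by
  refine ⟨fun _ => 1, fun n => binningCode h₁ h₂ fun _ => 0, ?_, ?_⟩
  · simp [rate]
  · refine tendsto_const_nhds.congr fun n => ?_
    symm
    refine sum_eq_zero fun w _ => sum_eq_zero fun s _ => ?_
    rw [if_neg (not_not.2 (Subsingleton.elim _ _)), mul_zero]

theorem isLUB_oneDirtyAchievable {q₁ q₂ : ℝ} (h₁ : 0 ≤ q₁) (h₁' : q₁ ≤ 1 / 2) (h₂ : 0 ≤ q₂) :
    IsLUB {R : ℝ | OneDirtyAchievable q₁ q₂ R} (Hb q₁) := by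
  refine ⟨fun R hR => OneDirtyAchievable.le_Hb h₁ h₁' hR, fun b hb => ?_⟩
  have hb0 : 0 ≤ b := hb (oneDirtyAchievable_zero h₁ h₂)
  refine le_of_forall_lt_imp_le_of_dense fun R hR => ?_
  rcases le_total R 0 with hR0 | hR0
  · exact hR0.trans hb0
  · exact hb (oneDirtyAchievable_of_lt h₁ h₁' h₂ hR0 hR)

/-! ### Entropy of random variables on a finite space -/

section Entropy

variable {Ω α β : Type} [Fintype Ω] {p : Ω → ℝ}

theorem sum_law_mul [Fintype α] [DecidableEq α] (A : Ω → α) (g : α → ℝ) :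
    ∑ a, law p A a * g a = ∑ ω, p ω * g (A ω) := by
  simp only [law, sum_mul, ite_mul, zero_mul]
  rw [sum_comm]
  simp

theorem entropy_eq_sum [Fintype α] [DecidableEq α] (A : Ω → α) :
    entropy p A = -∑ ω, p ω * Real.logb 2 (law p A (A ω)) := by
  rw [entropy, sum_law_mul A fun a => Real.logb 2 (law p A a)]

theorem law_nonneg [DecidableEq α] (hp : ∀ ω, 0 ≤ p ω) (A : Ω → α) (a : α) : 0 ≤ law p A a :=
  sum_nonneg fun ω _ => by split_ifs <;> simp [hp]

theorem le_law [DecidableEq α] (hp : ∀ ω, 0 ≤ p ω) (A : Ω → α) (ω : Ω) : p ω ≤ law p A (A ω) := by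
  have h := single_le_sum (f := fun ω' => if A ω' = A ω then p ω' else 0)
    (fun ω' _ => by split_ifs <;> simp [hp]) (mem_univ ω)
  simpa [law] using h

theorem sum_law [Fintype α] [DecidableEq α] (A : Ω → α) : ∑ a, law p A a = ∑ ω, p ω := by
  simpa using sum_law_mul (p := p) A fun _ => 1

/-- A random variable that is almost surely a function of another has at most its entropy. -/
theorem entropy_le_of_factors [Fintype α] [DecidableEq α] [Fintype β] [DecidableEq β]
    (hp : ∀ ω, 0 ≤ p ω) (A : Ω → α) (B : Ω → β)
    (h : ∀ ω ω', p ω ≠ 0 → p ω' ≠ 0 → A ω = A ω' → B ω = B ω') : entropy p B ≤ entropy p A := by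
  rw [entropy_eq_sum, entropy_eq_sum, neg_le_neg_iff]
  refine sum_le_sum fun ω _ => ?_
  rcases (hp ω).eq_or_lt with h0 | hpos
  · simp [← h0]
  refine mul_le_mul_of_nonneg_left ?_ hpos.le
  refine Real.logb_le_logb_of_le one_lt_two (hpos.trans_le (le_law hp A ω)) ?_
  refine sum_le_sum fun ω' _ => ?_
  rcases eq_or_ne (p ω') 0 with h0 | hne
  · simp [h0]
  by_cases hA : A ω' = A ω
  · rw [if_pos hA, if_pos (h ω' ω hne hpos.ne' hA)]
  · rw [if_neg hA]
    split_ifs <;> simp [hp]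

/-- Subadditivity of entropy, from `log x ≤ x - 1`. -/
theorem entropy_pair_le [Fintype α] [DecidableEq α] [Fintype β] [DecidableEq β]
    (hp : ∀ ω, 0 ≤ p ω) (h1 : ∑ ω, p ω = 1) (A : Ω → α) (B : Ω → β) :
    entropy p (fun ω => (A ω, B ω)) ≤ entropy p A + entropy p B := by
  set C : Ω → α × β := fun ω => (A ω, B ω) with hC
  have hl2 : 0 < Real.log 2 := Real.log_pos one_lt_two
  have key (ω : Ω) : p ω * Real.logb 2 (law p A (A ω)) + p ω * Real.logb 2 (law p B (B ω)) -
      p ω * Real.logb 2 (law p C (C ω)) ≤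
        (p ω * (law p A (A ω) * law p B (B ω) / law p C (C ω)) - p ω) / Real.log 2 := by
    rcases (hp ω).eq_or_lt with h0 | hpos
    · simp [← h0]
    have hA := hpos.trans_le (le_law hp A ω)
    have hB := hpos.trans_le (le_law hp B ω)
    have hCp := hpos.trans_le (le_law hp C ω)
    have hlog := Real.log_le_sub_one_of_pos (div_pos (mul_pos hA hB) hCp)
    rw [Real.log_div (mul_pos hA hB).ne' hCp.ne', Real.log_mul hA.ne' hB.ne'] at hlog
    rw [le_div_iff₀ hl2]
    simp only [Real.logb]
    calc _ = p ω * (Real.log (law p A (A ω)) + Real.log (law p B (B ω)) -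
          Real.log (law p C (C ω))) := by field_simp
      _ ≤ p ω * (law p A (A ω) * law p B (B ω) / law p C (C ω) - 1) := by gcongr
      _ = _ := by ring
  have hmass : ∑ ω, p ω * (law p A (A ω) * law p B (B ω) / law p C (C ω)) ≤ 1 := by
    rw [← sum_law_mul C fun c => law p A c.1 * law p B c.2 / law p C c]
    calc _ ≤ ∑ c : α × β, law p A c.1 * law p B c.2 := by
          refine sum_le_sum fun c _ => ?_
          have hAB := mul_nonneg (law_nonneg hp A c.1) (law_nonneg hp B c.2)
          rcases eq_or_ne (law p C c) 0 with h0 | hne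
          · simpa [h0] using hAB
          · rw [mul_div_cancel₀ _ hne]
      _ = 1 := by
          rw [Fintype.sum_prod_type]
          simp only [← mul_sum, sum_law, h1, mul_one]
  have hsum := sum_le_sum fun ω (_ : ω ∈ univ) => key ω
  rw [sum_sub_distrib, sum_add_distrib, ← sum_div, sum_sub_distrib, h1] at hsum
  have : (∑ ω, p ω * (law p A (A ω) * law p B (B ω) / law p C (C ω)) - 1) / Real.log 2 ≤ 0 :=
    div_nonpos_of_nonpos_of_nonneg (by linarith) hl2.le
  rw [entropy_eq_sum, entropy_eq_sum, entropy_eq_sum]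
  linarith

theorem entropy_binary (h1 : ∑ ω, p ω = 1) (A : Ω → ZMod 2) : entropy p A = Hb (law p A 1) := by
  have h := sum_law (p := p) A
  rw [sum_zmod_two, h1] at h
  rw [entropy, sum_zmod_two, eq_sub_of_add_eq h, Hb]
  ring

end Entropy

/-! ### The single-letter expression -/

theorem TestChannel.joint_nonneg {k : ℕ} (t : TestChannel k) (ω : Outcome k) : 0 ≤ t.joint ω := by
  have h1 := t.pX₂.2.1 (rvX₂ ω)
  have h2 := (t.pU₁ (rvX₂ ω) (rvS₁ ω)).2.1 (rvU₁ ω)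
  have h3 := (t.pX₁ (rvS₁ ω) (rvU₁ ω)).2.1 (rvX₁ ω)
  have h0 : 0 ≤ bernoulliHalf (rvS₁ ω) := by norm_num [bernoulliHalf]
  exact mul_nonneg (mul_nonneg (mul_nonneg h0 h1) h2) h3

theorem TestChannel.sum_joint_snd {k : ℕ} (t : TestChannel k) (s : ZMod 2) :
    ∑ x : ZMod 2 × Fin k × ZMod 2, t.joint (s, x) = 1 / 2 := by
  have h1 : ∑ x, (t.pX₂ : ZMod 2 → ℝ) x = 1 := t.pX₂.2.2
  have h2 (x : ZMod 2) : ∑ u, (t.pU₁ x s : Fin k → ℝ) u = 1 := (t.pU₁ x s).2.2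
  have h3 (u : Fin k) : ∑ x, (t.pX₁ s u : ZMod 2 → ℝ) x = 1 := (t.pX₁ s u).2.2
  simp only [Fintype.sum_prod_type, TestChannel.joint, rvS₁, rvX₂, rvU₁, rvX₁, ← mul_sum,
    bernoulliHalf, h3, mul_one, h2, h1]

theorem TestChannel.sum_joint {k : ℕ} (t : TestChannel k) : ∑ ω, t.joint ω = 1 := by
  rw [Fintype.sum_prod_type, sum_zmod_two, t.sum_joint_snd, t.sum_joint_snd]
  norm_num

theorem TestChannel.entropy_rvS₁ {k : ℕ} (t : TestChannel k) : entropy t.joint rvS₁ = 1 := by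
  have h : law t.joint rvS₁ 1 = 2⁻¹ := by
    rw [law, Fintype.sum_prod_type, sum_zmod_two]
    simp only [rvS₁]
    simpa using t.sum_joint_snd 1
  rw [entropy_binary t.sum_joint, h, Hb_eq_binEntropy_div, Real.binEntropy_two_inv,
    div_self (Real.log_pos one_lt_two).ne']

/-- The entropy of `(U₁, X₂)` cancels in the objective. -/
theorem TestChannel.value_eq {k : ℕ} (t : TestChannel k) :
    t.value = entropy t.joint rvY - 1 + entropy t.joint (fun ω => ((rvU₁ ω, rvX₂ ω), rvS₁ ω)) -
      entropy t.joint (fun ω => ((rvU₁ ω, rvX₂ ω), rvY ω)) := by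
  rw [TestChannel.value, mutualInfo, mutualInfo, t.entropy_rvS₁]
  ring

/-- Since `S₁ = X₁ + X₂ + Y`, the pair `((U₁, X₂), S₁)` is a function of `((U₁, X₂), Y)` and
`X₁`, so its entropy exceeds that of `((U₁, X₂), Y)` by at most `H(X₁)`. -/
theorem TestChannel.value_le {k : ℕ} (t : TestChannel k) {q₁ q₂ : ℝ} (h₁ : q₁ ≤ 1 / 2)
    (ht : t.Admissible q₁ q₂) : t.value ≤ Hb q₁ := by
  have hY : entropy t.joint rvY ≤ 1 := by
    rw [entropy_binary t.sum_joint]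
    exact Hb_le_one _
  have hX : entropy t.joint rvX₁ ≤ Hb q₁ := by
    rw [entropy_binary t.sum_joint]
    exact Hb_mono (law_nonneg t.joint_nonneg _ _) ht.1 h₁
  have hfun : entropy t.joint (fun ω => ((rvU₁ ω, rvX₂ ω), rvS₁ ω)) ≤
      entropy t.joint (fun ω => (((rvU₁ ω, rvX₂ ω), rvY ω), rvX₁ ω)) := by
    refine entropy_le_of_factors t.joint_nonneg _ _ fun ω ω' _ _ h => ?_
    simp only [Prod.mk.injEq, rvY] at h ⊢
    obtain ⟨⟨⟨hU, hX₂⟩, hY⟩, hX₁⟩ := h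
    refine ⟨⟨hU, hX₂⟩, ?_⟩
    rw [hX₁, hX₂] at hY
    exact add_left_cancel hY
  have hsub := entropy_pair_le t.joint_nonneg t.sum_joint
    (fun ω => ((rvU₁ ω, rvX₂ ω), rvY ω)) rvX₁
  rw [t.value_eq]
  linarith

/-- The identification of the alphabet `Fin 2` of the auxiliary variable with the bits. -/
def bit (u : Fin 2) : ZMod 2 := u

/-- The optimal test channel: `X₂ = 0`, `U₁ = X₁ + S₁` with `X₁` a Bernoulli(`q`) bit independent
of `S₁`. -/
def optimalChannel {q : ℝ} (h0 : 0 ≤ q) (h1 : q ≤ 1) : TestChannel 2 where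
  pX₂ := ⟨Pi.single 0 1, single_mem_stdSimplex ℝ 0⟩
  pU₁ _ s := ⟨fun u : ZMod 2 => if u = s then 1 - q else q, by
    refine ⟨fun u => by dsimp only; split_ifs <;> linarith, ?_⟩
    change ∑ u : ZMod 2, (if u = s then 1 - q else q) = 1
    rw [sum_zmod_two]
    obtain rfl | rfl : s = 0 ∨ s = 1 := by revert s; decide
    all_goals simp⟩
  pX₁ s u := ⟨Pi.single (bit u + s) 1, single_mem_stdSimplex ℝ _⟩

theorem optimalChannel_joint {q : ℝ} (h0 : 0 ≤ q) (h1 : q ≤ 1) (s x₂ u x₁ : ZMod 2) :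
    (optimalChannel h0 h1).joint (s, x₂, u, x₁) =
      if x₂ = 0 ∧ x₁ = u + s then (1 / 2) * (if u = s then 1 - q else q) else 0 := by
  change 1 / 2 * (Pi.single 0 1 : ZMod 2 → ℝ) x₂ * (if u = s then 1 - q else q) *
    (Pi.single (u + s) 1 : ZMod 2 → ℝ) x₁ = _
  rw [Pi.single_apply, Pi.single_apply]
  by_cases h2 : x₂ = 0 <;> by_cases h3 : x₁ = u + s <;> simp [h2, h3]

theorem sum_outcome {A : Type*} [AddCommMonoid A] (f : Outcome 2 → A) :
    ∑ ω, f ω = ∑ s : ZMod 2, ∑ x₂ : ZMod 2, ∑ u : ZMod 2, ∑ x₁ : ZMod 2, f (s, x₂, u, x₁) := by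
  simp only [Fintype.sum_prod_type]
  rfl

theorem optimalChannel_sum {q : ℝ} (h0 : 0 ≤ q) (h1 : q ≤ 1) (f : Outcome 2 → ℝ → ℝ)
    (hf : ∀ ω, f ω 0 = 0) : ∑ ω, f ω ((optimalChannel h0 h1).joint ω) =
      ∑ s : ZMod 2, ∑ u : ZMod 2,
        f (s, (0 : ZMod 2), u, u + s) (1 / 2 * (if u = s then 1 - q else q)) := by
  rw [sum_outcome]
  simp only [optimalChannel_joint]
  refine sum_congr rfl fun s _ => ?_
  rw [sum_eq_single 0 (fun x₂ _ h => by simp [h, hf]) (by simp)]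
  refine sum_congr rfl fun u _ => ?_
  rw [sum_eq_single (u + s) (fun x₁ _ h => by simp [h, hf]) (by simp)]
  simp

theorem optimalChannel_admissible {q₁ q₂ : ℝ} (h0 : 0 ≤ q₁) (h1 : q₁ ≤ 1) (h₂ : 0 ≤ q₂) :
    (optimalChannel h0 h1).Admissible q₁ q₂ := by
  constructor
  · rw [law, optimalChannel_sum h0 h1 (fun ω r => if rvX₁ ω = 1 then r else 0) (by simp)]
    simp only [rvX₁, sum_zmod_two]
    rw [CharTwo.add_self_eq_zero (1 : ZMod 2)]
    simp
    linarith
  · rw [law, optimalChannel_sum h0 h1 (fun ω r => if rvX₂ ω = 1 then r else 0) (by simp)]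
    simpa [rvX₂] using h₂

theorem half_mul_logb (x : ℝ) :
    1 / 2 * x * Real.logb 2 (1 / 2 * x) = 1 / 2 * (x * Real.logb 2 x) - 1 / 2 * x := by
  rcases eq_or_ne x 0 with rfl | hx
  · simp
  · rw [Real.logb_mul (by norm_num) hx, one_div, Real.logb_inv, Real.logb_self_eq_one one_lt_two]
    ring

theorem entropy_optimalChannel {q : ℝ} (h0 : 0 ≤ q) (h1 : q ≤ 1) :
    entropy (optimalChannel h0 h1).joint id = Hb q + 1 := by
  have hlaw (ω : Outcome 2) : law (optimalChannel h0 h1).joint id ω =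
      (optimalChannel h0 h1).joint ω := by
    simp [law]
  simp only [entropy, hlaw]
  rw [optimalChannel_sum h0 h1 (fun _ r => r * Real.logb 2 r) (by simp)]
  simp only [half_mul_logb, sum_zmod_two, if_true, if_neg (show (0 : ZMod 2) ≠ 1 by decide),
    if_neg (show (1 : ZMod 2) ≠ 0 by decide), Hb]
  ring

theorem le_value_optimalChannel {q : ℝ} (h0 : 0 ≤ q) (h1 : q ≤ 1) :
    Hb q ≤ (optimalChannel h0 h1).value := by
  set t := optimalChannel h0 h1 with ht
  have hsupp (ω : Outcome 2) (h : t.joint ω ≠ 0) :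
      rvX₂ ω = 0 ∧ rvX₁ ω = bit (rvU₁ ω) + rvS₁ ω := by
    obtain ⟨s, x₂, u, x₁⟩ := ω
    rw [ht, optimalChannel_joint h0 h1 s x₂ u x₁] at h
    by_contra hne
    exact h (if_neg hne)
  have hY (ω : Outcome 2) (h : t.joint ω ≠ 0) : rvY ω = bit (rvU₁ ω) := by
    obtain ⟨h2, h3⟩ := hsupp ω h
    rw [rvY, h2, h3, add_zero, add_assoc, CharTwo.add_self_eq_zero, add_zero]
  have hVY : entropy t.joint (fun ω => ((rvU₁ ω, rvX₂ ω), rvY ω)) ≤ entropy t.joint rvY := by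
    refine entropy_le_of_factors t.joint_nonneg _ _ fun ω ω' h h' heq => ?_
    have hU : rvU₁ ω = rvU₁ ω' := (hY ω h).symm.trans (heq.trans (hY ω' h'))
    simp only [heq, hU, (hsupp ω h).1, (hsupp ω' h').1]
  have hVS : entropy t.joint id ≤ entropy t.joint (fun ω => ((rvU₁ ω, rvX₂ ω), rvS₁ ω)) := by
    refine entropy_le_of_factors t.joint_nonneg _ _ fun ω ω' h h' heq => ?_
    simp only [Prod.mk.injEq] at heq
    obtain ⟨⟨hU, hX₂⟩, hS⟩ := heq
    have hX₁ : rvX₁ ω = rvX₁ ω' := by rw [(hsupp ω h).2, (hsupp ω' h').2, hU, hS]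
    exact Prod.ext hS (Prod.ext hX₂ (Prod.ext hU hX₁))
  rw [t.value_eq]
  rw [ht, entropy_optimalChannel] at hVS
  linarith

theorem isGreatest_singleLetterValues {q₁ q₂ : ℝ} (h₁ : 0 ≤ q₁) (h₁' : q₁ ≤ 1 / 2) (h₂ : 0 ≤ q₂) :
    IsGreatest (singleLetterValues q₁ q₂) (Hb q₁) := by
  have h1 : q₁ ≤ 1 := by linarith
  constructor
  · have hadm := optimalChannel_admissible h₁ h1 h₂
    exact ⟨2, optimalChannel h₁ h1, hadm,
      le_antisymm (TestChannel.value_le _ h₁' hadm) (le_value_optimalChannel h₁ h1)⟩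
  · rintro r ⟨k, t, hadm, rfl⟩
    exact t.value_le h₁' hadm

end DirtyMAC

end

theorem mainTheorem3 (q₁ q₂ : ℝ) (hq₁ : 0 ≤ q₁) (hq₁' : q₁ ≤ 1 / 2)
    (hq₂ : 0 ≤ q₂) (hq₂' : q₂ ≤ 1 / 2) :
    IsLUB {R : ℝ | DirtyMAC.OneDirtyAchievable q₁ q₂ R} (DirtyMAC.Hb q₁) ∧
    IsGreatest (DirtyMAC.singleLetterValues q₁ q₂) (DirtyMAC.Hb q₁) ∧
    (∀ R₁ R₂ : ℝ, DirtyMAC.DoublyDirtyAchievable q₁ q₂ R₁ R₂ →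
      R₁ + R₂ ≤ min (DirtyMAC.Hb q₁) (DirtyMAC.Hb q₂)) := by
  refine ⟨DirtyMAC.isLUB_oneDirtyAchievable hq₁ hq₁' hq₂,
    DirtyMAC.isGreatest_singleLetterValues hq₁ hq₁' hq₂, fun R₁ R₂ h => le_min ?_ ?_⟩
  · exact h.add_le_Hb hq₁ hq₁'
  · rw [add_comm]
    exact h.swap.add_le_Hb hq₂ hq₂'
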